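/- Let $\gamma$ be a nonnegative random variable, let $n\in\mathbb N$, and let $a_1,\dots,a_n,b_1,\dots,b_n\in\mathbb C$ satisfy $\operatorname{Re}a_i>0$ for all $i$ and $\beta:=\sum_{i=1}^n b_i\in(0,\infty)$. Suppose that $\gamma$ has the monomial moment generating function $$M_\gamma(s)=\mathbb E[e^{s\gamma}]=\prod_{i=1}^n\Bigl(1-\frac{s}{a_i}\Bigr)^{-b_i}\qquad(s\in\mathbb C,\ \operatorname{Re}s\le 0).$$ All complex powers are principal values. Write $(z)_k=z(z+1)\cdots(z+k-1)$, and for $m\in\mathbb N_0^n$ write $|m|=m_1+\dots+m_n$. (i) For every $x\ge 0$ the cumulative distribution function $F_\gamma(x)=\mathbb P(\gamma\le x)$ is $$F_\gamma(x)=\frac{\prod_{i=1}^n a_i^{b_i}}{\Gamma(1+\beta)}\,x^{\beta}\,\Phi_2^{(n)}\bigl(b_1,\dots,b_n;1+\beta;-a_1x,\dots,-a_nx\bigr),$$ where $$\Phi_2^{(n)}(b_1,\dots,b_n;c;x_1,\dots,x_n)=\sum_{m\in\mathbb N_0^n}\frac{(b_1)_{m_1}\cdots(b_n)_{m_n}}{(c)_{|m|}}\,\frac{x_1^{m_1}\cdots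 x_n^{m_n}}{m_1!\cdots m_n!}$$ is the confluent Lauricella function; its series converges absolutely at the point in question. (ii) Let $Q(x)=\frac1{\sqrt{2\pi}}\int_x^\infty e^{-u^2/2}\,du$. For every $p>0$ the Gaussian $Q$-transform of $\gamma$ is $$\mathbb E\bigl[Q(\sqrt{p\gamma})\bigr]=\frac{1}{2\sqrt\pi}\Bigl(\prod_{i=1}^n a_i^{b_i}\Bigr)\frac{\Gamma(\tfrac12+\beta)}{\Gamma(1+\beta)}\Bigl(\frac2p\Bigr)^{\beta}F_D^{(n)}\Bigl(\tfrac12+\beta,b_1,\dots,b_n;1+\beta;-\frac{2a_1}{p},\dots,-\frac{2a_n}{p}\Bigr),$$ where the Lauricella function $F_D^{(n)}(\alpha,b_1,\dots,b_n;c;\cdot)$ is the (unique) holomorphic function on $(\mathbb C\setminus[1,\infty))^n$ which, on the polydisc $|x_1|<1,\dots,|x_n|<1$, is the sum of the absolutely convergent series $$\sum_{m\in\mathbb N_0^n}\frac{(\alpha)_{|m|}(b_1)_{m_1}\cdots(b_n)_{m_n}}{(c)_{|m|}}\,\frac{x_1^{m_1}\cdots x_n^{m_n}}{m_1!\cdots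 m_n!};$$ such a function exists for $\alpha=\tfrac12+\beta$, $c=1+\beta$. -/

import Mathlib

open MeasureTheory ProbabilityTheory

noncomputable section

/-- The Gaussian tail function `Q(x) = (2π)^{-1/2} ∫_x^∞ exp(-u²/2) du`. -/
def gaussianQ (x : ℝ) : ℝ :=
  (Real.sqrt (2 * Real.pi))⁻¹ * ∫ u in Set.Ioi x, Real.exp (-u ^ 2 / 2)

/-- The Gaussian `Q`-transform `p ↦ E[Q(√(p γ))]` of a random variable `γ`. -/
def gaussianQTransform {Ω : Type*} [MeasurableSpace Ω] (μ : Measure Ω) (γ : Ω → ℝ) (p : ℝ) : ℝ :=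
  ∫ ω, gaussianQ (Real.sqrt (p * γ ω)) ∂μ

/-- The rising factorial (Pochhammer symbol) `(z)_k = z (z+1) ⋯ (z+k-1)`. -/
def risingFactorial (z : ℂ) (k : ℕ) : ℂ := (ascPochhammer ℂ k).eval z

/-- The term with multi-index `m` of the series of the confluent Lauricella function
`Φ₂^{(n)}(b₁,…,bₙ; c; x₁,…,xₙ)`. -/
def lauricellaPhi2Term {n : ℕ} (b : Fin n → ℂ) (c : ℂ) (x : Fin n → ℂ) (m : Fin n → ℕ) : ℂ :=
  (∏ i, risingFactorial (b i) (m i)) / risingFactorial c (∑ i, m i) *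
    ∏ i, x i ^ m i / ((m i).factorial : ℂ)

/-- The confluent Lauricella function `Φ₂^{(n)}(b₁,…,bₙ; c; x₁,…,xₙ)`, an everywhere absolutely
convergent power series in `x` (for `c ∉ {0, -1, -2, …}`). -/
def lauricellaPhi2 {n : ℕ} (b : Fin n → ℂ) (c : ℂ) (x : Fin n → ℂ) : ℂ :=
  ∑' m : Fin n → ℕ, lauricellaPhi2Term b c x m

/-- The term with multi-index `m` of the series of the Lauricella function
`F_D^{(n)}(α, b₁,…,bₙ; c; x₁,…,xₙ)`. -/
def lauricellaFDTerm {n : ℕ} (α : ℂ) (b : Fin n → ℂ) (c : ℂ) (x : Fin n → ℂ)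
    (m : Fin n → ℕ) : ℂ :=
  risingFactorial α (∑ i, m i) * (∏ i, risingFactorial (b i) (m i)) /
      risingFactorial c (∑ i, m i) *
    ∏ i, x i ^ m i / ((m i).factorial : ℂ)

/-- The domain `(ℂ ∖ [1, ∞))ⁿ` of the principal branch of `F_D^{(n)}`. -/
def lauricellaFDDomain (n : ℕ) : Set (Fin n → ℂ) :=
  {x | ∀ i, 1 - x i ∈ Complex.slitPlane}

/-- `F` is the principal branch of `F_D^{(n)}(α, b; c; ·)`: it is holomorphic on `(ℂ ∖ [1, ∞))ⁿ`
and it is the sum of the Lauricella series on the open unit polydisc. -/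
def IsLauricellaFD {n : ℕ} (α : ℂ) (b : Fin n → ℂ) (c : ℂ) (F : (Fin n → ℂ) → ℂ) : Prop :=
  DifferentiableOn ℂ F (lauricellaFDDomain n) ∧
    ∀ x : Fin n → ℂ, (∀ i, ‖x i‖ < 1) → HasSum (lauricellaFDTerm α b c x) (F x)

/-- The principal branch is unique on `(ℂ ∖ [1, ∞))ⁿ`. -/
theorem IsLauricellaFD.eqOn {n : ℕ} {α : ℂ} {b : Fin n → ℂ} {c : ℂ} {F G : (Fin n → ℂ) → ℂ}
    (hF : IsLauricellaFD α b c F) (hG : IsLauricellaFD α b c G) :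
    Set.EqOn F G (lauricellaFDDomain n) := by
  intro x hx
  let U : Set ℂ := {z | z • x ∈ lauricellaFDDomain n}
  have hUo : IsOpen U := by
    have : U = ⋂ i, (fun z : ℂ => 1 - z * x i) ⁻¹' Complex.slitPlane := by
      ext z; simp [U, lauricellaFDDomain]
    rw [this]
    exact isOpen_iInter_of_finite fun i =>
      Complex.isOpen_slitPlane.preimage (by fun_prop)
  have hU0 : (0 : ℂ) ∈ U := by
    intro i; simp
  have hU1 : (1 : ℂ) ∈ U := by
    simpa [U] using hx
  have hUs : StarConvex ℝ (0 : ℂ) U := by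
    rw [starConvex_zero_iff]
    intro z hz t ht0 ht1 i
    have h := Complex.starConvex_one_slitPlane (hz i) (sub_nonneg.2 ht1) ht0 (by ring)
    convert h using 1
    simp only [Pi.smul_apply, smul_eq_mul, Complex.real_smul]
    push_cast
    ring
  have hline : ∀ H : (Fin n → ℂ) → ℂ, DifferentiableOn ℂ H (lauricellaFDDomain n) →
      AnalyticOnNhd ℂ (fun z : ℂ => H (z • x)) U := fun H hH =>
    DifferentiableOn.analyticOnNhd
      (hH.comp (t := lauricellaFDDomain n) (f := fun z : ℂ => z • x) (by fun_prop)
        (fun z hz => hz)) hUo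
  have hev : (fun z : ℂ => F (z • x)) =ᶠ[nhds 0] fun z : ℂ => G (z • x) := by
    have hn : ∀ᶠ z : ℂ in nhds 0, ∀ i, ‖(z • x) i‖ < 1 := by
      rw [Filter.eventually_all]
      intro i
      have hc : ContinuousAt (fun z : ℂ => ‖(z • x) i‖) 0 := by
        simp only [Pi.smul_apply, smul_eq_mul]; fun_prop
      exact hc.eventually_lt continuousAt_const (by simp)
    filter_upwards [hn] with z hz
    exact (hF.2 _ hz).unique (hG.2 _ hz)
  have h := (hline F hF.1).eqOn_of_preconnected_of_eventuallyEq (hline G hG.1)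
    (hUs.isPathConnected hU0).isConnected.isPreconnected hU0 hev hU1
  simpa using h

/-- The Lauricella function `F_D^{(n)}(α, b₁,…,bₙ; c; x₁,…,xₙ)`, as a function of `x`: the sum of
its series on the open unit polydisc, continued analytically to `(ℂ ∖ [1, ∞))ⁿ`. -/
def lauricellaFD {n : ℕ} (α : ℂ) (b : Fin n → ℂ) (c : ℂ) : (Fin n → ℂ) → ℂ :=
  Classical.epsilon (IsLauricellaFD α b c)

end

/-! The proof runs through Laplace transforms. Fubini gives `∫ e^{-tx} F(x) dx = M(-t)/t` for the
distribution function `F`, and the product formula rewrites this as `∏ aᵢ^{bᵢ} · t^{-1-β} ∏ (1 +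
aᵢ/t)^{-bᵢ}`. For `t` larger than every `‖aᵢ‖` the binomial series expand it in powers of `1/t`, and
each `t^{-1-β-k}` is the transform of `x^{β+k}/Γ(1+β+k)`: the inverse transform is the `Φ₂` series.

Rigorously, `laplace_lauricellaPhi2` transforms `x^{ν-1} Φ₂(b; c; ax)` into `Γ(ν) t^{-ν} F_D(ν, b;
c; a/t)`. For `ν = c` the `F_D` series collapses to a product of binomials, so both sides of (i)
have equal transforms for large `t`; Lerch's theorem and right continuity conclude.

For (ii), `Q(√(py))` is a tail integral of a multiple of `x^{-1/2} e^{-px/2}`, so the `Q`-transform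
is a multiple of the Laplace transform of `x^{-1/2} F(x)` at `p/2`. The case `ν = 1/2 + β`, `c = 1 +
β` evaluates it for large `p`. For small `p` the series is unavailable, but both sides are
holomorphic on `Re z > 0` and the identity theorem extends the equality. Euler's integral supplies
the principal branch of `F_D`, since `1/2 + β < 1 + β`. -/

section LauricellaTransforms

open Set Filter Topology

/-! ### Multiple binomial series and the Lauricella terms -/

theorem summable_norm_and_hasSum_pi_prod {n : ℕ} (f : Fin n → ℕ → ℂ)
    (hf : ∀ i, Summable fun k => ‖f i k‖) :
    (Summable fun m : Fin n → ℕ => ‖∏ i, f i (m i)‖) ∧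
      HasSum (fun m : Fin n → ℕ => ∏ i, f i (m i)) (∏ i, ∑' k, f i k) := by
  induction n with
  | zero =>
    refine ⟨(hasSum_fintype _).summable, ?_⟩
    simp
  | succ n ih =>
    obtain ⟨h1, h2⟩ := ih (fun i => f i.succ) fun i => hf i.succ
    let e := Fin.consEquiv (fun _ : Fin (n + 1) => ℕ)
    have he : ∀ q : ℕ × (Fin n → ℕ), ∏ i, f i (e q i) = f 0 q.1 * ∏ i, f i.succ (q.2 i) := by
      intro q
      simp [e, Fin.prod_univ_succ, Fin.consEquiv]
    constructor
    · rw [← e.summable_iff]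
      refine (Summable.mul_norm (hf 0) h1).congr fun q => ?_
      simp only [Function.comp, he]
    · rw [← e.hasSum_iff]
      have h3 := summable_mul_of_summable_norm (hf 0) h1
      have h4 := (hf 0).of_norm.hasSum.mul h2 h3
      rw [Fin.prod_univ_succ]
      rw [show (fun m : Fin (n + 1) → ℕ => ∏ i, f i (m i)) ∘ e = _ from funext he]
      exact h4

theorem risingFactorial_zero (z : ℂ) : risingFactorial z 0 = 1 := by simp [risingFactorial]

theorem risingFactorial_succ (z : ℂ) (k : ℕ) :
    risingFactorial z (k + 1) = risingFactorial z k * (z + k) := by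
  simp [risingFactorial, ascPochhammer_succ_right]

theorem choose_add_sub_one_eq (b : ℂ) (k : ℕ) :
    Ring.choose (b + k - 1) k = risingFactorial b k / (k.factorial : ℂ) := by
  rw [eq_div_iff (by exact_mod_cast k.factorial_ne_zero), ← Ring.multichoose_eq, mul_comm,
    ← nsmul_eq_mul, Ring.factorial_nsmul_multichoose_eq_ascPochhammer,
    Polynomial.ascPochhammer_smeval_eq_eval, risingFactorial]

theorem one_sub_cpow_neg_series (b : ℂ) {z : ℂ} (hz : ‖z‖ < 1) :
    (Summable fun k : ℕ => ‖risingFactorial b k / (k.factorial : ℂ) * z ^ k‖) ∧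
      HasSum (fun k : ℕ => risingFactorial b k / (k.factorial : ℂ) * z ^ k)
        ((1 - z) ^ (-b)) := by
  have h := Complex.one_div_one_sub_cpow_hasFPowerSeriesOnBall_zero b
  have hz' : z ∈ Metric.eball (0 : ℂ) 1 := by
    simpa [enorm_eq_nnnorm, ← NNReal.coe_lt_coe] using hz
  constructor
  · have := FormalMultilinearSeries.summable_norm_apply _ (Metric.eball_subset_eball h.r_le hz')
    refine this.congr fun k => ?_
    rw [FormalMultilinearSeries.ofScalars_apply_eq, choose_add_sub_one_eq, smul_eq_mul]
  · have := h.hasSum hz'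
    simp only [zero_add, one_div, ← Complex.cpow_neg] at this
    refine this.congr_fun fun k => ?_
    rw [FormalMultilinearSeries.ofScalars_apply_eq, choose_add_sub_one_eq, smul_eq_mul]

theorem prod_one_sub_cpow_neg_series {n : ℕ} (b x : Fin n → ℂ) (hx : ∀ i, ‖x i‖ < 1) :
    (Summable fun m : Fin n → ℕ =>
        ‖∏ i, risingFactorial (b i) (m i) / ((m i).factorial : ℂ) * x i ^ m i‖) ∧
      HasSum (fun m : Fin n → ℕ =>
        ∏ i, risingFactorial (b i) (m i) / ((m i).factorial : ℂ) * x i ^ m i)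
        (∏ i, (1 - x i) ^ (-b i)) := by
  obtain ⟨h1, h2⟩ := summable_norm_and_hasSum_pi_prod
    (fun i k => risingFactorial (b i) k / (k.factorial : ℂ) * x i ^ k)
    fun i => (one_sub_cpow_neg_series (b i) (hx i)).1
  refine ⟨h1, ?_⟩
  convert h2 using 1
  exact Finset.prod_congr rfl fun i _ => (one_sub_cpow_neg_series (b i) (hx i)).2.tsum_eq.symm

theorem lauricellaFDTerm_eq {n : ℕ} (α : ℂ) (b : Fin n → ℂ) (c : ℂ) (x : Fin n → ℂ)
    (m : Fin n → ℕ) :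
    lauricellaFDTerm α b c x m = risingFactorial α (∑ i, m i) / risingFactorial c (∑ i, m i) *
      ∏ i, risingFactorial (b i) (m i) / ((m i).factorial : ℂ) * x i ^ m i := by
  simp only [lauricellaFDTerm, Finset.prod_mul_distrib, Finset.prod_div_distrib]
  ring

theorem lauricellaPhi2Term_eq {n : ℕ} (b : Fin n → ℂ) (c : ℂ) (x : Fin n → ℂ)
    (m : Fin n → ℕ) :
    lauricellaPhi2Term b c x m = 1 / risingFactorial c (∑ i, m i) *
      ∏ i, risingFactorial (b i) (m i) / ((m i).factorial : ℂ) * x i ^ m i := by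
  simp only [lauricellaPhi2Term, Finset.prod_mul_distrib, Finset.prod_div_distrib]
  ring

theorem lauricellaPhi2Term_mul {n : ℕ} (b : Fin n → ℂ) (c : ℂ) (x : Fin n → ℂ) (z : ℂ)
    (m : Fin n → ℕ) :
    lauricellaPhi2Term b c (fun i => x i * z) m =
      lauricellaPhi2Term b c x m * z ^ (∑ i, m i) := by
  simp only [lauricellaPhi2Term_eq, mul_pow, Finset.prod_mul_distrib, Finset.prod_pow_eq_pow_sum]
  ring

/-- Only the factor `(α)_{|m|}` separates the two series; the Gamma integral will supply it. -/
theorem lauricellaFDTerm_mul {n : ℕ} (α : ℂ) (b : Fin n → ℂ) (c : ℂ) (x : Fin n → ℂ) (z : ℂ)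
    (m : Fin n → ℕ) :
    lauricellaFDTerm α b c (fun i => x i * z) m =
      risingFactorial α (∑ i, m i) * lauricellaPhi2Term b c x m * z ^ (∑ i, m i) := by
  simp only [lauricellaFDTerm_eq, lauricellaPhi2Term_eq, mul_pow, Finset.prod_mul_distrib,
    Finset.prod_pow_eq_pow_sum]
  ring

/-! ### Majorants, convergence and continuity -/

theorem norm_add_natCast_of_pos {c : ℝ} (hc : 0 < c) (k : ℕ) : ‖(c : ℂ) + k‖ = c + k := by
  rw [show (c : ℂ) + k = ((c + k : ℝ) : ℂ) by push_cast; rfl, Complex.norm_real,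
    Real.norm_of_nonneg (by positivity)]

theorem norm_risingFactorial_pos {c : ℝ} (hc : 0 < c) (k : ℕ) :
    0 < ‖risingFactorial (c : ℂ) k‖ := by
  induction k with
  | zero => simp [risingFactorial_zero]
  | succ k ih =>
    rw [risingFactorial_succ, norm_mul, norm_add_natCast_of_pos hc]
    positivity

theorem norm_risingFactorial_mono {a c : ℝ} (ha : 0 < a) (hac : a ≤ c) (k : ℕ) :
    ‖risingFactorial (a : ℂ) k‖ ≤ ‖risingFactorial (c : ℂ) k‖ := by
  induction k with
  | zero => simp [risingFactorial_zero]
  | succ k ih =>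
    rw [risingFactorial_succ, risingFactorial_succ, norm_mul, norm_mul,
      norm_add_natCast_of_pos ha, norm_add_natCast_of_pos (ha.trans_le hac)]
    gcongr

theorem norm_risingFactorial_one (k : ℕ) : ‖risingFactorial ((1 : ℝ) : ℂ) k‖ = k.factorial := by
  induction k with
  | zero => simp [risingFactorial_zero]
  | succ k ih =>
    rw [risingFactorial_succ, norm_mul, ih, norm_add_natCast_of_pos one_pos, Nat.factorial_succ]
    push_cast
    ring

/-- The ratio `(α)_k/(c)_k` has norm at most one, so the product of binomial series is a majorant.
-/
theorem summable_norm_lauricellaFDTerm {n : ℕ} {α c : ℝ} (hα : 0 < α) (hαc : α ≤ c)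
    (b x : Fin n → ℂ) (hx : ∀ i, ‖x i‖ < 1) :
    Summable fun m => ‖lauricellaFDTerm (α : ℂ) b (c : ℂ) x m‖ := by
  refine Summable.of_nonneg_of_le (fun _ => norm_nonneg _) (fun m => ?_)
    (prod_one_sub_cpow_neg_series b x hx).1
  rw [lauricellaFDTerm_eq, norm_mul]
  refine mul_le_of_le_one_left (norm_nonneg _) ?_
  rw [norm_div]
  exact div_le_one_of_le₀ (norm_risingFactorial_mono hα hαc _) (norm_nonneg _)

theorem hasSum_lauricellaFDTerm_self {n : ℕ} {c : ℝ} (hc : 0 < c)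
    (b x : Fin n → ℂ) (hx : ∀ i, ‖x i‖ < 1) :
    HasSum (lauricellaFDTerm (c : ℂ) b (c : ℂ) x) (∏ i, (1 - x i) ^ (-b i)) := by
  convert (prod_one_sub_cpow_neg_series b x hx).2 using 1
  ext m
  rw [lauricellaFDTerm_eq, div_self (norm_pos_iff.1 (norm_risingFactorial_pos hc _)), one_mul]

/-- A summable majorant of the series of `Φ₂`, at exponential cost. -/
theorem norm_lauricellaPhi2Term_le {n : ℕ} {c : ℝ} (hc : 1 ≤ c) (b a : Fin n → ℂ) {R : ℝ}
    (hR : 0 < R) {x : ℝ} (hx : 0 ≤ x) (m : Fin n → ℕ) :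
    ‖lauricellaPhi2Term b (c : ℂ) (fun i => a i * (x : ℂ)) m‖ ≤
      ‖∏ i, risingFactorial (b i) (m i) / ((m i).factorial : ℂ) * (a i / (R : ℂ)) ^ m i‖ *
        Real.exp (R * x) := by
  -- Rescale `aᵢ x = (aᵢ/R)(Rx)`. As `c ≥ 1`, the denominator dominates `k!`, and `(Rx)^k/k! ≤
  -- e^{Rx}`.
  have h : lauricellaPhi2Term b (c : ℂ) (fun i => a i * (x : ℂ)) m =
      (∏ i, risingFactorial (b i) (m i) / ((m i).factorial : ℂ) * (a i / (R : ℂ)) ^ m i) *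
        (((R * x : ℝ) : ℂ) ^ (∑ i, m i) / risingFactorial c (∑ i, m i)) := by
    have hR' : (R : ℂ) ≠ 0 := by exact_mod_cast hR.ne'
    have : (fun i => a i * (x : ℂ)) = fun i => (a i / (R : ℂ)) * ((R * x : ℝ) : ℂ) := by
      ext i; push_cast; field_simp
    rw [this, lauricellaPhi2Term_mul, lauricellaPhi2Term_eq]
    ring
  rw [h, norm_mul]
  refine mul_le_mul_of_nonneg_left ?_ (norm_nonneg _)
  have h0 : 0 ≤ R * x := by positivity
  rw [norm_div, norm_pow, Complex.norm_real, Real.norm_of_nonneg h0]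
  refine le_trans ?_ (Real.pow_div_factorial_le_exp _ h0 (∑ i, m i))
  rw [← norm_risingFactorial_one]
  exact div_le_div_of_nonneg_left (by positivity) (norm_risingFactorial_pos one_pos _)
    (norm_risingFactorial_mono one_pos hc _)

theorem exists_norm_bound {n : ℕ} (a : Fin n → ℂ) : ∃ R : ℝ, 0 < R ∧ ∀ i, ‖a i‖ < R := by
  refine ⟨‖a‖ + 1, by positivity, fun i => ?_⟩
  linarith [norm_le_pi_norm a i]

theorem norm_div_ofReal_lt_one {z : ℂ} {R : ℝ} (h : ‖z‖ < R) : ‖z / (R : ℂ)‖ < 1 := by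
  have hR : 0 < R := (norm_nonneg z).trans_lt h
  rw [norm_div, Complex.norm_real, Real.norm_of_nonneg hR.le, div_lt_one hR]
  exact h

theorem summable_lauricellaPhi2Term {n : ℕ} {c : ℝ} (hc : 1 ≤ c) (b a : Fin n → ℂ)
    {x : ℝ} (hx : 0 ≤ x) :
    Summable (lauricellaPhi2Term b (c : ℂ) (fun i => a i * (x : ℂ))) := by
  obtain ⟨R, hR, haR⟩ := exists_norm_bound a
  exact Summable.of_norm_bounded
    (((prod_one_sub_cpow_neg_series b _ fun i => norm_div_ofReal_lt_one (haR i)).1).mul_right _)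
    fun m => norm_lauricellaPhi2Term_le hc b a hR hx m

/-- Any rate `R` above all `‖aᵢ‖` is allowed, so the Laplace integral converges for every `t` above
them. -/
theorem norm_lauricellaPhi2_le {n : ℕ} {c : ℝ} (hc : 1 ≤ c) (b a : Fin n → ℂ) {R : ℝ}
    (haR : ∀ i, ‖a i‖ < R) (hR : 0 < R) :
    ∃ K : ℝ, ∀ x : ℝ, 0 ≤ x →
      ‖lauricellaPhi2 b (c : ℂ) (fun i => a i * (x : ℂ))‖ ≤ K * Real.exp (R * x) := by
  have hs := (prod_one_sub_cpow_neg_series b _ fun i => norm_div_ofReal_lt_one (haR i)).1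
  obtain ⟨K, hK⟩ := hs
  refine ⟨K, fun x hx => ?_⟩
  rw [lauricellaPhi2]
  exact tsum_of_norm_bounded (hK.mul_right _)
    fun m => norm_lauricellaPhi2Term_le hc b a hR hx m

/-- The majorant grows like `e^{Rx}`, so the M-test is applied on bounded intervals and continuity
is local. -/
theorem continuousOn_lauricellaPhi2 {n : ℕ} {c : ℝ} (hc : 1 ≤ c) (b a : Fin n → ℂ) :
    ContinuousOn (fun x : ℝ => lauricellaPhi2 b (c : ℂ) (fun i => a i * (x : ℂ))) (Ici 0) := by
  obtain ⟨R, hR, haR⟩ := exists_norm_bound a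
  have hs := (prod_one_sub_cpow_neg_series b _ fun i => norm_div_ofReal_lt_one (haR i)).1
  have key : ∀ N : ℝ, ContinuousOn
      (fun x : ℝ => lauricellaPhi2 b (c : ℂ) (fun i => a i * (x : ℂ))) (Icc 0 N) := by
    intro N
    refine continuousOn_tsum (u := fun m => _ * Real.exp (R * N)) (fun m => ?_)
      (hs.mul_right _) fun m x hx => ?_
    · simp only [lauricellaPhi2Term_mul]
      fun_prop
    · refine (norm_lauricellaPhi2Term_le hc b a hR hx.1 m).trans ?_
      have := hx.2
      gcongr
  intro x hx
  refine ((key (x + 1)) x ⟨hx, by linarith⟩).mono_of_mem_nhdsWithin ?_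
  exact inter_mem_nhdsWithin _ (Iic_mem_nhds (by linarith))

/-! ### Termwise Laplace transform -/

theorem Gamma_add_natCast {ν : ℝ} (hν : 0 < ν) (k : ℕ) :
    ((Real.Gamma (ν + k) : ℝ) : ℂ) = Real.Gamma ν * risingFactorial ν k := by
  have h : ∀ j : ℕ, (ν : ℂ) ≠ -j := by
    intro j hj
    have : ν = -j := by exact_mod_cast hj
    have : (0 : ℝ) ≤ j := j.cast_nonneg
    linarith
  have := Complex.Gamma_add_nat_div_Gamma_eq (n := k) (ν : ℂ) h
  have hne : Complex.Gamma ν ≠ 0 := Complex.Gamma_ne_zero h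
  rw [risingFactorial, ← this, ← Complex.Gamma_ofReal, ← Complex.Gamma_ofReal]
  push_cast
  field_simp

theorem integrableOn_rpow_mul_exp_neg_mul {ν t : ℝ} (hν : 0 < ν) (ht : 0 < t) :
    IntegrableOn (fun x : ℝ => x ^ (ν - 1) * Real.exp (-(t * x))) (Ioi 0) := by
  have := integrableOn_rpow_mul_exp_neg_mul_rpow (s := ν - 1) (p := 1) (b := t)
    (by linarith) one_pos ht
  simpa [neg_mul] using this

theorem laplace_rpow_mul_pow {ν t : ℝ} (hν : 0 < ν) (ht : 0 < t) (k : ℕ) :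
    IntegrableOn (fun x : ℝ => x ^ (ν - 1) * Real.exp (-(t * x)) * x ^ k) (Ioi 0) ∧
    ∫ x in Ioi (0 : ℝ), x ^ (ν - 1) * Real.exp (-(t * x)) * x ^ k =
      Real.Gamma (ν + k) * ((1 / t) ^ ν * (1 / t) ^ k) := by
  have hk : 0 < ν + k := by positivity
  have heq : EqOn (fun x : ℝ => x ^ (ν + k - 1) * Real.exp (-(t * x)))
      (fun x : ℝ => x ^ (ν - 1) * Real.exp (-(t * x)) * x ^ k) (Ioi 0) := by
    intro x hx
    have hx' : 0 < x := hx
    simp only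
    rw [show ν + k - 1 = (ν - 1) + k by ring, Real.rpow_add_natCast hx'.ne']
    ring
  refine ⟨(integrableOn_rpow_mul_exp_neg_mul hk ht).congr_fun heq measurableSet_Ioi, ?_⟩
  rw [← setIntegral_congr_fun measurableSet_Ioi heq, Real.integral_rpow_mul_exp_neg_mul_Ioi hk ht,
    Real.rpow_add_natCast (by positivity)]
  ring

/-- Termwise Laplace transform of `x ^ (ν - 1) Φ₂(b; c; a₁ x, …, aₙ x)`. -/
theorem laplace_lauricellaPhi2 {n : ℕ} {ν c t : ℝ} (hν : 0 < ν) (hνc : ν ≤ c) (hc : 1 ≤ c)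
    (b a : Fin n → ℂ) (hat : ∀ i, ‖a i‖ < t) (ht : 0 < t) :
    IntegrableOn (fun x : ℝ => ((x ^ (ν - 1) * Real.exp (-(t * x)) : ℝ) : ℂ) *
      lauricellaPhi2 b (c : ℂ) (fun i => a i * (x : ℂ))) (Ioi 0) ∧
    HasSum (fun m => ((Real.Gamma ν * (1 / t) ^ ν : ℝ) : ℂ) *
        lauricellaFDTerm (ν : ℂ) b (c : ℂ) (fun i => a i / (t : ℂ)) m)
      (∫ x in Ioi (0 : ℝ), ((x ^ (ν - 1) * Real.exp (-(t * x)) : ℝ) : ℂ) *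
        lauricellaPhi2 b (c : ℂ) (fun i => a i * (x : ℂ))) := by
  have hterm : ∀ (x : ℝ) (m : Fin n → ℕ),
      ((x ^ (ν - 1) * Real.exp (-(t * x)) : ℝ) : ℂ) *
        lauricellaPhi2Term b (c : ℂ) (fun i => a i * (x : ℂ)) m =
      lauricellaPhi2Term b (c : ℂ) a m *
        ((x ^ (ν - 1) * Real.exp (-(t * x)) * x ^ (∑ i, m i) : ℝ) : ℂ) := by
    intro x m
    rw [lauricellaPhi2Term_mul]
    push_cast
    ring
  have hint : ∀ m : Fin n → ℕ, Integrable (fun x : ℝ =>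
      ((x ^ (ν - 1) * Real.exp (-(t * x)) : ℝ) : ℂ) *
        lauricellaPhi2Term b (c : ℂ) (fun i => a i * (x : ℂ)) m) (volume.restrict (Ioi 0)) := by
    intro m
    simp only [hterm]
    exact (laplace_rpow_mul_pow hν ht _).1.ofReal.const_mul _
  have hFD : ∀ m : Fin n → ℕ, lauricellaPhi2Term b (c : ℂ) a m *
      ((Real.Gamma (ν + (∑ i, m i : ℕ)) * ((1 / t) ^ ν * (1 / t) ^ (∑ i, m i)) : ℝ) : ℂ) =
      ((Real.Gamma ν * (1 / t) ^ ν : ℝ) : ℂ) *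
        lauricellaFDTerm (ν : ℂ) b (c : ℂ) (fun i => a i / (t : ℂ)) m := by
    intro m
    simp only [div_eq_mul_inv (a _)]
    rw [lauricellaFDTerm_mul, Complex.ofReal_mul, Gamma_add_natCast hν]
    push_cast
    rw [one_div]
    ring
  have hval : ∀ m : Fin n → ℕ, ∫ x in Ioi (0 : ℝ),
      ((x ^ (ν - 1) * Real.exp (-(t * x)) : ℝ) : ℂ) *
        lauricellaPhi2Term b (c : ℂ) (fun i => a i * (x : ℂ)) m =
      ((Real.Gamma ν * (1 / t) ^ ν : ℝ) : ℂ) *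
        lauricellaFDTerm (ν : ℂ) b (c : ℂ) (fun i => a i / (t : ℂ)) m := by
    intro m
    simp only [hterm]
    rw [integral_const_mul, integral_complex_ofReal, (laplace_rpow_mul_pow hν ht _).2, hFD]
  -- The kernel is nonnegative on the half-line, so no cancellation is lost: summability of these
  -- integrals is absolute convergence of `F_D` at `a/t`.
  have hnorm : ∀ m : Fin n → ℕ, ∫ x in Ioi (0 : ℝ),
      ‖((x ^ (ν - 1) * Real.exp (-(t * x)) : ℝ) : ℂ) *
        lauricellaPhi2Term b (c : ℂ) (fun i => a i * (x : ℂ)) m‖ =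
      ‖((Real.Gamma ν * (1 / t) ^ ν : ℝ) : ℂ) *
        lauricellaFDTerm (ν : ℂ) b (c : ℂ) (fun i => a i / (t : ℂ)) m‖ := by
    intro m
    rw [← hFD, norm_mul, Complex.norm_real, ← (laplace_rpow_mul_pow hν ht _).2,
      Real.norm_of_nonneg, ← integral_const_mul]
    · refine setIntegral_congr_fun measurableSet_Ioi fun x hx => ?_
      have hx' : (0 : ℝ) < x := hx
      rw [hterm, norm_mul, Complex.norm_real, Real.norm_of_nonneg (by positivity)]
    · refine setIntegral_nonneg measurableSet_Ioi fun x hx => ?_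
      have hx' : (0 : ℝ) < x := hx
      positivity
  have hsum : Summable fun m : Fin n → ℕ => ∫ x in Ioi (0 : ℝ),
      ‖((x ^ (ν - 1) * Real.exp (-(t * x)) : ℝ) : ℂ) *
        lauricellaPhi2Term b (c : ℂ) (fun i => a i * (x : ℂ)) m‖ := by
    rw [summable_congr hnorm]
    simp only [norm_mul]
    exact (summable_norm_lauricellaFDTerm hν hνc b _
      fun i => norm_div_ofReal_lt_one (hat i)).mul_left _
  constructor
  · obtain ⟨R, hR1, hRt⟩ : ∃ R, (∀ i, ‖a i‖ < R) ∧ R < t := by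
      have h0 : ‖a‖ < t := (pi_norm_lt_iff ht).2 hat
      obtain ⟨R, h1, h2⟩ := exists_between h0
      exact ⟨R, fun i => (norm_le_pi_norm a i).trans_lt h1, h2⟩
    -- The maximum with `t / 2` records positivity while staying below `t`.
    obtain ⟨R, hR1, hR0, hRt⟩ : ∃ R, (∀ i, ‖a i‖ < R) ∧ 0 < R ∧ R < t :=
      ⟨max R (t / 2), fun i => (hR1 i).trans_le (le_max_left _ _),
        lt_max_of_lt_right (by positivity), max_lt hRt (by linarith)⟩
    obtain ⟨K, hK⟩ := norm_lauricellaPhi2_le hc b a hR1 hR0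
    refine Integrable.mono' ((integrableOn_rpow_mul_exp_neg_mul hν
      (sub_pos.2 hRt)).const_mul K) ?_ ?_
    · refine ContinuousOn.aestronglyMeasurable ?_ measurableSet_Ioi
      refine ContinuousOn.mul ?_ ((continuousOn_lauricellaPhi2 hc b a).mono Ioi_subset_Ici_self)
      refine Complex.continuous_ofReal.comp_continuousOn ?_
      refine ContinuousOn.mul (fun x hx => ?_) (by fun_prop)
      exact (Real.continuousAt_rpow_const _ _ (Or.inl (ne_of_gt hx))).continuousWithinAt
    · refine (ae_restrict_iff' measurableSet_Ioi).2 (.of_forall fun x hx => ?_)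
      have hx' : (0 : ℝ) < x := hx
      rw [norm_mul, Complex.norm_real, Real.norm_of_nonneg (by positivity)]
      calc _ ≤ x ^ (ν - 1) * Real.exp (-(t * x)) * (K * Real.exp (R * x)) := by
            gcongr
            exact hK x hx'.le
        _ = K * (x ^ (ν - 1) * (Real.exp (-(t * x)) * Real.exp (R * x))) := by ring
        _ = _ := by
            rw [← Real.exp_add]
            ring_nf
  · have := hasSum_integral_of_summable_integral_norm hint hsum
    simp only [hval, tsum_mul_left] at this
    exact this

/-! ### Uniqueness of the Laplace transform -/

/-- Substitute `u = e^{-x}`. Compact support makes `g(-log u)` vanish for small `u > 0`, so it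
extends continuously by zero and Weierstrass applies on `[0, 1]`. -/
theorem exists_polynomial_exp_neg_near {g : ℝ → ℝ} (hg : Continuous g) (hgs : HasCompactSupport g)
    {ε : ℝ} (hε : 0 < ε) :
    ∃ p : Polynomial ℝ, ∀ x : ℝ, 0 ≤ x → |p.eval (Real.exp (-x)) - g x| < ε := by
  obtain ⟨N, hN⟩ : ∃ N : ℝ, ∀ x, N < x → g x = 0 := by
    obtain ⟨N, hN⟩ := hgs.isCompact.bddAbove
    refine ⟨N, fun x hx => ?_⟩
    by_contra h
    exact absurd (hN (subset_tsupport g h)) (not_le.2 hx)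
  let h : ℝ → ℝ := fun u => if u ≤ 0 then 0 else g (-Real.log u)
  have hh : Continuous h := by
    rw [continuous_iff_continuousAt]
    intro u
    rcases le_or_gt u 0 with hu | hu
    · have : h =ᶠ[𝓝 u] fun _ => 0 := by
        filter_upwards [Iio_mem_nhds (hu.trans_lt (Real.exp_pos (-N)))] with v hv
        by_cases hv0 : v ≤ 0
        · simp [h, hv0]
        · simp only [h, hv0, if_false]
          apply hN
          have := (Real.log_lt_iff_lt_exp (not_le.1 hv0)).2 hv
          linarith
      exact continuousAt_const.congr this.symm
    · have : h =ᶠ[𝓝 u] fun v => g (-Real.log v) := by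
        filter_upwards [Ioi_mem_nhds hu] with v hv
        simp [h, not_le.2 (mem_Ioi.1 hv)]
      refine ContinuousAt.congr ?_ this.symm
      exact hg.continuousAt.comp (Real.continuousAt_log hu.ne').neg
  obtain ⟨p, hp⟩ := exists_polynomial_near_of_continuousOn 0 1 h hh.continuousOn ε hε
  refine ⟨p, fun x hx => ?_⟩
  have := hp (Real.exp (-x)) ⟨(Real.exp_pos _).le, Real.exp_le_one_iff.2 (by linarith)⟩
  simpa [h, not_le.2 (Real.exp_pos _)] using this

/-- Lerch's theorem: a function on the half-line is determined by the values of its Laplace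
transform along an arithmetic progression. -/
theorem ae_eq_zero_of_laplace_eq_zero {f : ℝ → ℂ} {T : ℝ}
    (hf : IntegrableOn (fun x : ℝ => (Real.exp (-(T * x)) : ℂ) * f x) (Ioi 0))
    (h : ∀ k : ℕ, ∫ x in Ioi (0 : ℝ), (Real.exp (-((T + k) * x)) : ℂ) * f x = 0) :
    ∀ᵐ x ∂volume.restrict (Ioi (0 : ℝ)), f x = 0 := by
  set F : ℝ → ℂ := fun x => (Real.exp (-(T * x)) : ℂ) * f x with hF
  have hpow : ∀ (k : ℕ) (x : ℝ),
      ((Real.exp (-x) ^ k : ℝ) : ℂ) * F x = (Real.exp (-((T + k) * x)) : ℂ) * f x := by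
    intro k x
    rw [hF, ← mul_assoc, ← Complex.ofReal_mul, ← Real.exp_nat_mul, ← Real.exp_add]
    ring_nf
  have hpint : ∀ k : ℕ, IntegrableOn (fun x => ((Real.exp (-x) ^ k : ℝ) : ℂ) * F x) (Ioi 0) := by
    intro k
    refine Integrable.mono hf ?_ ?_
    · exact (by fun_prop : Continuous fun x : ℝ =>
        ((Real.exp (-x) ^ k : ℝ) : ℂ)).aestronglyMeasurable.mul hf.1
    · refine (ae_restrict_iff' measurableSet_Ioi).2 (.of_forall fun x hx => ?_)
      have hx' : (0 : ℝ) < x := hx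
      rw [norm_mul, Complex.norm_real, Real.norm_of_nonneg (by positivity)]
      exact mul_le_of_le_one_left (norm_nonneg _)
        (pow_le_one₀ (Real.exp_pos _).le (Real.exp_le_one_iff.2 (by linarith)))
  have hpoly : ∀ p : Polynomial ℝ,
      IntegrableOn (fun x => ((p.eval (Real.exp (-x)) : ℝ) : ℂ) * F x) (Ioi 0) ∧
      ∫ x in Ioi (0 : ℝ), ((p.eval (Real.exp (-x)) : ℝ) : ℂ) * F x = 0 := by
    intro p
    have heq : (fun x => ((p.eval (Real.exp (-x)) : ℝ) : ℂ) * F x) = fun x =>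
        ∑ k ∈ Finset.range (p.natDegree + 1),
          (p.coeff k : ℂ) * (((Real.exp (-x) ^ k : ℝ) : ℂ) * F x) := by
      ext x
      rw [Polynomial.eval_eq_sum_range, Complex.ofReal_sum, Finset.sum_mul]
      refine Finset.sum_congr rfl fun k _ => ?_
      push_cast
      ring
    rw [heq]
    refine ⟨integrable_finsetSum _ fun k _ => (hpint k).const_mul _, ?_⟩
    rw [integral_finsetSum _ fun k _ => (hpint k).const_mul _]
    refine Finset.sum_eq_zero fun k _ => ?_
    rw [integral_const_mul]
    simp only [hpow]
    rw [h k, mul_zero]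
  have hF0 : ∀ᵐ x ∂volume.restrict (Ioi (0 : ℝ)), F x = 0 := by
    -- A test function is uniformly close to a polynomial in `e^{-x}`, whose integral against `F`
    -- vanishes; the error is at most the tolerance times the `L¹` norm `I` of `F`.
    refine ae_eq_zero_of_integral_contDiff_smul_eq_zero hf.locallyIntegrable fun g hg hgs => ?_
    have hgint : IntegrableOn (fun x => g x • F x) (Ioi 0) := by
      obtain ⟨C, hC⟩ := hgs.exists_bound_of_continuous hg.continuous
      exact Integrable.bdd_smul (φ := g) hf C hg.continuous.aestronglyMeasurable (.of_forall hC)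
    rw [← norm_le_zero_iff]
    refine le_of_forall_pos_le_add fun δ hδ => ?_
    set I := ∫ x in Ioi (0 : ℝ), ‖F x‖ with hI
    have hI0 : 0 ≤ I := integral_nonneg fun _ => norm_nonneg _
    obtain ⟨p, hp⟩ := exists_polynomial_exp_neg_near hg.continuous hgs
      (div_pos hδ (by linarith : 0 < I + 1))
    have hsub : ∫ x in Ioi (0 : ℝ), g x • F x = ∫ x in Ioi (0 : ℝ),
        (g x • F x - ((p.eval (Real.exp (-x)) : ℝ) : ℂ) * F x) := by
      rw [integral_sub hgint (hpoly p).1, (hpoly p).2, sub_zero]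
    have hbound : ‖∫ x in Ioi (0 : ℝ), g x • F x‖ ≤ δ / (I + 1) * I := by
      rw [hsub, hI, ← integral_const_mul]
      refine norm_integral_le_of_norm_le (hf.norm.const_mul _) ?_
      refine (ae_restrict_iff' measurableSet_Ioi).2 (.of_forall fun x hx => ?_)
      rw [Complex.real_smul, ← sub_mul, ← Complex.ofReal_sub, norm_mul, Complex.norm_real,
        Real.norm_eq_abs, abs_sub_comm]
      exact mul_le_mul_of_nonneg_right (hp x (le_of_lt hx)).le (norm_nonneg _)
    refine hbound.trans ?_
    rw [zero_add, div_mul_eq_mul_div, div_le_iff₀ (by linarith)]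
    nlinarith
  filter_upwards [hF0] with x hx
  exact (mul_eq_zero.1 hx).resolve_left (by exact_mod_cast (Real.exp_pos _).ne')

/-! ### Fubini for the distribution function; the Gaussian tail -/

theorem integrableOn_cdf_mul (P : Measure ℝ) {w : ℝ → ℝ} {s : Set ℝ} (hw : IntegrableOn w s) :
    IntegrableOn (fun x => cdf P x * w x) s := by
  refine Integrable.bdd_mul (c := 1) hw (cdf P).mono.measurable.aestronglyMeasurable
    (.of_forall fun x => ?_)
  rw [Real.norm_of_nonneg (cdf_nonneg P x)]
  exact cdf_le_one P x

/-- Write the distribution function as the `P`-integral of the indicator of `y ≤ x` and exchange the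
integrals. -/
theorem integral_cdf_mul (P : Measure ℝ) [IsProbabilityMeasure P] (hP : ∀ᵐ y ∂P, 0 ≤ y)
    {w : ℝ → ℝ} (hw : IntegrableOn w (Ioi 0)) :
    ∫ x in Ioi (0 : ℝ), cdf P x * w x = ∫ y, (∫ x in Ioi y, w x) ∂P := by
  have hms : MeasurableSet {q : ℝ × ℝ | q.2 ≤ q.1} :=
    measurableSet_le measurable_snd measurable_fst
  have hint : Integrable (Function.uncurry fun x y : ℝ =>
      {q : ℝ × ℝ | q.2 ≤ q.1}.indicator (fun q => w q.1) (x, y))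
      ((volume.restrict (Ioi 0)).prod P) :=
    (Integrable.comp_fst hw P).indicator hms
  have h1 : ∀ x, ∫ y, {q : ℝ × ℝ | q.2 ≤ q.1}.indicator (fun q => w q.1) (x, y) ∂P =
      cdf P x * w x := by
    intro x
    have : (fun y => {q : ℝ × ℝ | q.2 ≤ q.1}.indicator (fun q => w q.1) (x, y)) =
        (Iic x).indicator fun _ => w x := by
      ext y
      simp [indicator_apply]
    rw [this, integral_indicator measurableSet_Iic, setIntegral_const, cdf_eq_real, smul_eq_mul]
  rw [← setIntegral_congr_fun measurableSet_Ioi fun x _ => h1 x, integral_integral_swap hint]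
  refine integral_congr_ae ?_
  filter_upwards [hP] with y hy
  have : (fun x => {q : ℝ × ℝ | q.2 ≤ q.1}.indicator (fun q => w q.1) (x, y)) =
      (Ici y).indicator w := by
    ext x
    simp [indicator_apply]
  -- With closed half-lines the intersection is exactly `Ici y`, including when `y = 0`.
  rw [this, ← integral_Ici_eq_integral_Ioi, ← integral_Ici_eq_integral_Ioi,
    setIntegral_indicator measurableSet_Ici, inter_eq_right.2 (Ici_subset_Ici.2 hy)]

/-- Substitute `u = √(px)`; the tail form is what `integral_cdf_mul` consumes. -/
theorem gaussianQ_sqrt_mul {p y : ℝ} (hp : 0 < p) (hy : 0 ≤ y) :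
    gaussianQ (Real.sqrt (p * y)) = ∫ x in Ioi y, Real.sqrt p / (2 * Real.sqrt (2 * Real.pi)) *
      (x ^ ((1 / 2 : ℝ) - 1) * Real.exp (-(p / 2 * x))) := by
  have himg : (fun x => Real.sqrt (p * x)) '' Ioi y = Ioi (Real.sqrt (p * y)) := by
    ext u
    constructor
    · rintro ⟨x, hx, rfl⟩
      exact Real.sqrt_lt_sqrt (by positivity) (mul_lt_mul_of_pos_left hx hp)
    · intro hu
      have hu0 : 0 ≤ u := (Real.sqrt_nonneg _).trans (le_of_lt hu)
      refine ⟨u ^ 2 / p, ?_, ?_⟩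
      · have := (Real.sqrt_lt' ((Real.sqrt_nonneg _).trans_lt hu)).1 hu
        rw [mem_Ioi, lt_div_iff₀ hp]
        linarith
      · simp only
        rw [mul_div_cancel₀ _ hp.ne', Real.sqrt_sq hu0]
  have hder : ∀ x ∈ Ioi y, HasDerivWithinAt (fun x => Real.sqrt (p * x))
      (p / (2 * Real.sqrt (p * x))) (Ioi y) x := by
    intro x hx
    have hx0 : 0 < x := hy.trans_lt hx
    have := ((hasDerivAt_id x).const_mul p).sqrt (by simpa using (mul_pos hp hx0).ne')
    simpa using this.hasDerivWithinAt
  have hinj : InjOn (fun x => Real.sqrt (p * x)) (Ioi y) := by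
    intro x hx x' hx' h
    have hx0 : 0 < x := hy.trans_lt hx
    have hx0' : 0 < x' := hy.trans_lt hx'
    have := (Real.sqrt_inj (by positivity) (by positivity)).1 h
    exact mul_left_cancel₀ hp.ne' this
  rw [gaussianQ, ← himg, integral_image_eq_integral_abs_deriv_smul measurableSet_Ioi hder hinj,
    ← integral_const_mul]
  refine setIntegral_congr_fun measurableSet_Ioi fun x hx => ?_
  have hx0 : 0 < x := hy.trans_lt hx
  have hsx : x ^ ((1 / 2 : ℝ) - 1) = (Real.sqrt x)⁻¹ := by
    rw [Real.sqrt_eq_rpow, ← Real.rpow_neg hx0.le]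
    norm_num
  have hexp : -Real.sqrt (p * x) ^ 2 / 2 = -(p / 2 * x) := by
    rw [Real.sq_sqrt (by positivity)]
    ring
  simp only [smul_eq_mul]
  rw [hsx, hexp, abs_of_nonneg (by positivity), Real.sqrt_mul hp.le]
  have h1 : Real.sqrt p ≠ 0 := by positivity
  have h2 : Real.sqrt x ≠ 0 := by positivity
  have h3 : Real.sqrt (2 * Real.pi) ≠ 0 := by positivity
  field_simp
  rw [Real.sq_sqrt hp.le]

theorem integral_Ioi_exp_neg_mul {t : ℝ} (ht : 0 < t) (y : ℝ) :
    ∫ x in Ioi y, Real.exp (-(t * x)) = Real.exp (-(t * y)) / t := by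
  have := integral_exp_mul_Ioi (neg_lt_zero.2 ht) y
  simp only [neg_mul] at this
  rw [this, neg_div_neg_eq]

/-! ### Euler's integral and the principal branch of `F_D` -/

theorem isOpen_lauricellaFDDomain (n : ℕ) : IsOpen (lauricellaFDDomain n) := by
  rw [show lauricellaFDDomain n = ⋂ i, (fun x : Fin n → ℂ => 1 - x i) ⁻¹' Complex.slitPlane by
    ext; simp [lauricellaFDDomain]]
  exact isOpen_iInter_of_finite fun i => Complex.isOpen_slitPlane.preimage (by fun_prop)

theorem smul_mem_lauricellaFDDomain {n : ℕ} {x : Fin n → ℂ} (hx : x ∈ lauricellaFDDomain n)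
    {u : ℝ} (hu : u ∈ Icc (0 : ℝ) 1) (i : Fin n) : 1 - (u : ℂ) * x i ∈ Complex.slitPlane := by
  have h := Complex.starConvex_one_slitPlane (hx i) (sub_nonneg.2 hu.2) hu.1 (by ring)
  convert h using 1
  simp only [Complex.real_smul]
  push_cast
  ring

/-- The kernel `∏ (1 - w xᵢ) ^ (-bᵢ)` of Euler's integral, as a function of `(w, x)`. -/
noncomputable def eulerKernel {n : ℕ} (b : Fin n → ℂ) (q : ℂ × (Fin n → ℂ)) : ℂ :=
  ∏ i, (1 - q.1 * q.2 i) ^ (-b i)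

/-- The open set on which the Euler kernel is analytic. -/
def eulerKernelDomain (n : ℕ) : Set (ℂ × (Fin n → ℂ)) :=
  {q | ∀ i, 1 - q.1 * q.2 i ∈ Complex.slitPlane}

theorem analyticOnNhd_eulerKernel {n : ℕ} (b : Fin n → ℂ) :
    AnalyticOnNhd ℂ (eulerKernel b) (eulerKernelDomain n) := by
  intro q hq
  refine Finset.analyticAt_fun_prod _ fun i _ => ?_
  refine AnalyticAt.cpow ?_ analyticAt_const (hq i)
  refine analyticAt_const.sub (analyticAt_fst.mul ?_)
  exact ((ContinuousLinearMap.proj (R := ℂ) (φ := fun _ : Fin n => ℂ) i).analyticAt q.2).comp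
    analyticAt_snd

theorem isOpen_eulerKernelDomain (n : ℕ) : IsOpen (eulerKernelDomain n) := by
  rw [show eulerKernelDomain n =
    ⋂ i, (fun q : ℂ × (Fin n → ℂ) => 1 - q.1 * q.2 i) ⁻¹' Complex.slitPlane by
    ext; simp [eulerKernelDomain]]
  exact isOpen_iInter_of_finite fun i => Complex.isOpen_slitPlane.preimage (by fun_prop)

theorem prodMk_mem_eulerKernelDomain {n : ℕ} {x : Fin n → ℂ} (hx : x ∈ lauricellaFDDomain n)
    {u : ℝ} (hu : u ∈ Icc (0 : ℝ) 1) : ((u : ℂ), x) ∈ eulerKernelDomain n :=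
  smul_mem_lauricellaFDDomain hx hu

/-- The weight may be singular but does not involve `x`. The `x`-derivative of the kernel is
continuous, so by compactness of `[0, 1]` it is bounded uniformly for `x` near `x₀`, and one
differentiates under the integral. -/
theorem differentiableOn_integral_eulerKernel {n : ℕ} (b : Fin n → ℂ) {W : ℝ → ℂ}
    (hW : IntegrableOn W (Ioc 0 1)) :
    DifferentiableOn ℂ (fun x => ∫ u in Ioc (0 : ℝ) 1, W u * eulerKernel b ((u : ℂ), x))
      (lauricellaFDDomain n) := by
  intro x₀ hx₀
  have hana := analyticOnNhd_eulerKernel b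
  have hcK : ∀ x ∈ lauricellaFDDomain n,
      ContinuousOn (fun u : ℝ => eulerKernel b ((u : ℂ), x)) (Icc 0 1) := fun x hx =>
    hana.continuousOn.comp (by fun_prop) fun u hu => prodMk_mem_eulerKernelDomain hx hu
  let D : (Fin n → ℂ) → ℝ → (Fin n → ℂ) →L[ℂ] ℂ := fun x u =>
    (fderiv ℂ (eulerKernel b) ((u : ℂ), x)).comp (ContinuousLinearMap.inr ℂ ℂ (Fin n → ℂ))
  have hcD' : ContinuousOn (fun q : ℂ × (Fin n → ℂ) => (fderiv ℂ (eulerKernel b) q).comp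
      (ContinuousLinearMap.inr ℂ ℂ (Fin n → ℂ))) (eulerKernelDomain n) :=
    hana.fderiv.continuousOn.clm_comp continuousOn_const
  have hcD : ContinuousOn (D x₀) (Icc 0 1) :=
    hcD'.comp (f := fun u : ℝ => ((u : ℂ), x₀)) (by fun_prop)
      fun u hu => prodMk_mem_eulerKernelDomain hx₀ hu
  obtain ⟨C, hC⟩ := isCompact_Icc.exists_bound_of_continuousOn hcD
  have hnear : ∀ᶠ x in 𝓝 x₀, ∀ u ∈ Icc (0 : ℝ) 1, ‖D x u‖ ≤ C + 1 := by
    refine isCompact_Icc.eventually_forall_of_forall_eventually fun u hu => ?_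
    have hmem := prodMk_mem_eulerKernelDomain hx₀ hu
    have hat : ContinuousAt (fun z : (Fin n → ℂ) × ℝ => ‖D z.1 z.2‖) (x₀, u) := by
      have h1 := hcD'.continuousAt ((isOpen_eulerKernelDomain n).mem_nhds hmem)
      exact (ContinuousAt.comp (f := fun z : (Fin n → ℂ) × ℝ => ((z.2 : ℂ), z.1)) (x := (x₀, u))
        h1 (by fun_prop)).norm
    have hlt : ‖D x₀ u‖ < C + 1 := (hC u hu).trans_lt (lt_add_one C)
    exact (hat.eventually_lt continuousAt_const hlt).mono fun _ h => h.le
  have hdom := (isOpen_lauricellaFDDomain n).mem_nhds hx₀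
  have hmeas : ∀ x ∈ lauricellaFDDomain n, AEStronglyMeasurable
      (fun u : ℝ => W u * eulerKernel b ((u : ℂ), x)) (volume.restrict (Ioc 0 1)) := fun x hx =>
    hW.1.mul (((hcK x hx).mono Ioc_subset_Icc_self).aestronglyMeasurable measurableSet_Ioc)
  refine (HasFDerivAt.differentiableAt (hasFDerivAt_integral_of_dominated_of_fderiv_le
    (F' := fun x u => W u • D x u) (bound := fun u => ‖W u‖ * (C + 1))
    (inter_mem hdom hnear) ?_ ?_ ?_ ?_ ?_ ?_)).differentiableWithinAt
  · exact mem_of_superset hdom hmeas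
  · obtain ⟨M, hM⟩ := isCompact_Icc.exists_bound_of_continuousOn (hcK x₀ hx₀)
    refine Integrable.mul_bdd (c := M) hW
      (((hcK x₀ hx₀).mono Ioc_subset_Icc_self).aestronglyMeasurable measurableSet_Ioc) ?_
    exact (ae_restrict_iff' measurableSet_Ioc).2
      (.of_forall fun u hu => hM u (Ioc_subset_Icc_self hu))
  · exact hW.1.smul ((hcD.mono Ioc_subset_Icc_self).aestronglyMeasurable measurableSet_Ioc)
  · refine (ae_restrict_iff' measurableSet_Ioc).2 (.of_forall fun u hu x hx => ?_)
    rw [norm_smul]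
    exact mul_le_mul_of_nonneg_left (hx.2 u (Ioc_subset_Icc_self hu)) (norm_nonneg _)
  · exact hW.norm.mul_const _
  · refine (ae_restrict_iff' measurableSet_Ioc).2 (.of_forall fun u hu x hx => ?_)
    have h1 := (hana _ (prodMk_mem_eulerKernelDomain hx.1
      (Ioc_subset_Icc_self hu))).differentiableAt.hasFDerivAt
    have h2 := h1.comp x (hasFDerivAt_prodMk_right (u : ℂ) x)
    exact h2.const_mul (W u)

theorem Gamma_add_natCast_complex {ν : ℝ} (hν : 0 < ν) (k : ℕ) :
    Complex.Gamma ((ν : ℂ) + k) = Complex.Gamma ν * risingFactorial ν k := by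
  have := Gamma_add_natCast hν k
  rw [← Complex.Gamma_ofReal, ← Complex.Gamma_ofReal] at this
  push_cast at this
  exact this

theorem Gamma_ofReal_ne_zero {ν : ℝ} (hν : 0 < ν) : Complex.Gamma ν ≠ 0 :=
  Complex.Gamma_ne_zero_of_re_pos (by simpa using hν)

theorem betaIntegral_add_natCast {α δ : ℝ} (hα : 0 < α) (hδ : 0 < δ) (k : ℕ) :
    Complex.betaIntegral ((α : ℂ) + k) δ = Complex.betaIntegral α δ *
      (risingFactorial α k / risingFactorial ((α + δ : ℝ) : ℂ) k) := by
  have hαk : 0 < ((α : ℂ) + k).re := by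
    simp only [Complex.add_re, Complex.ofReal_re, Complex.natCast_re]
    positivity
  have h1 := Complex.Gamma_mul_Gamma_eq_betaIntegral (s := (α : ℂ)) (t := δ)
    (by simpa using hα) (by simpa using hδ)
  have h2 := Complex.Gamma_mul_Gamma_eq_betaIntegral hαk (t := δ) (by simpa using hδ)
  have hs : (α : ℂ) + k + δ = ((α + δ : ℝ) : ℂ) + k := by push_cast; ring
  rw [hs, Gamma_add_natCast_complex hα, Gamma_add_natCast_complex (add_pos hα hδ)] at h2
  rw [← Complex.ofReal_add] at h1
  have hg := Gamma_ofReal_ne_zero (add_pos hα hδ)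
  have hr := norm_pos_iff.1 (norm_risingFactorial_pos (add_pos hα hδ) k)
  rw [← mul_div_assoc, eq_div_iff hr]
  refine mul_left_cancel₀ hg ?_
  linear_combination (-1 : ℂ) * h2 + risingFactorial (α : ℂ) k * h1

/-- Euler's integral representation provides the principal branch of `F_D`. -/
theorem exists_isLauricellaFD {n : ℕ} {α c : ℝ} (hα : 0 < α) (hαc : α < c) (b : Fin n → ℂ) :
    ∃ F, IsLauricellaFD (α : ℂ) b (c : ℂ) F := by
  -- The weight `u^{α-1}(1-u)^{δ-1}` is integrable because `δ = c - α` is positive.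
  obtain ⟨δ, hδ, rfl⟩ : ∃ δ, 0 < δ ∧ c = α + δ := ⟨c - α, sub_pos.2 hαc, by ring⟩
  let W : ℝ → ℂ := fun u => (u : ℂ) ^ ((α : ℂ) - 1) * (1 - (u : ℂ)) ^ ((δ : ℂ) - 1)
  have hW : IntegrableOn W (Ioc 0 1) :=
    (Complex.betaIntegral_convergent (u := (α : ℂ)) (v := (δ : ℂ)) (by simpa using hα)
      (by simpa using hδ)).1
  set B := Complex.betaIntegral α δ with hB
  have hB0 : B ≠ 0 := by
    intro h0
    have h1 := Complex.Gamma_mul_Gamma_eq_betaIntegral (s := (α : ℂ)) (t := δ)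
      (by simpa using hα) (by simpa using hδ)
    rw [← hB, h0, mul_zero] at h1
    exact mul_ne_zero (Gamma_ofReal_ne_zero hα) (Gamma_ofReal_ne_zero hδ) h1
  refine ⟨fun x => B⁻¹ * ∫ u in Ioc (0 : ℝ) 1, W u * eulerKernel b ((u : ℂ), x),
    (differentiableOn_integral_eulerKernel b hW).const_mul _, fun x hx => ?_⟩
  let E : (Fin n → ℕ) → ℂ := fun m =>
    ∏ i, risingFactorial (b i) (m i) / ((m i).factorial : ℂ) * x i ^ m i
  have hE : Summable fun m => ‖E m‖ := (prod_one_sub_cpow_neg_series b x hx).1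
  have hpow : ∀ k : ℕ, IntegrableOn (fun u : ℝ => W u * (u : ℂ) ^ k) (Ioc 0 1) ∧
      ∫ u in Ioc (0 : ℝ) 1, W u * (u : ℂ) ^ k =
        B * (risingFactorial α k / risingFactorial ((α + δ : ℝ) : ℂ) k) := by
    intro k
    constructor
    · refine Integrable.mul_bdd (c := 1) hW (by fun_prop) ?_
      refine (ae_restrict_iff' measurableSet_Ioc).2 (.of_forall fun u hu => ?_)
      rw [norm_pow, Complex.norm_real, Real.norm_of_nonneg hu.1.le]
      exact pow_le_one₀ hu.1.le hu.2
    · rw [← betaIntegral_add_natCast hα hδ, Complex.betaIntegral,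
        intervalIntegral.integral_of_le zero_le_one]
      refine setIntegral_congr_fun measurableSet_Ioc fun u hu => ?_
      have hu0 : (u : ℂ) ≠ 0 := by exact_mod_cast hu.1.ne'
      simp only [W]
      rw [show (α : ℂ) + k - 1 = (α - 1) + k by ring, Complex.cpow_add _ _ hu0,
        Complex.cpow_natCast]
      ring
  -- Expand the kernel and integrate termwise: `u^{|m|} ≤ 1` gives the majorant `‖E m‖ ∫ ‖W‖`, and
  -- the beta integrals produce `(α)_k/(c)_k`.
  have hsum := hasSum_integral_of_summable_integral_norm
    (μ := volume.restrict (Ioc (0 : ℝ) 1)) (F := fun m u => E m * (W u * (u : ℂ) ^ (∑ i, m i)))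
    (fun m => (hpow _).1.const_mul _) (by
      refine Summable.of_nonneg_of_le (fun m => integral_nonneg fun _ => norm_nonneg _)
        (fun m => ?_) (hE.mul_right (∫ u in Ioc (0 : ℝ) 1, ‖W u‖))
      rw [← integral_const_mul]
      refine setIntegral_mono_on ((hpow _).1.const_mul _).norm (hW.norm.const_mul _)
        measurableSet_Ioc fun u hu => ?_
      rw [norm_mul, norm_mul, norm_pow, Complex.norm_real, Real.norm_of_nonneg hu.1.le]
      exact mul_le_mul_of_nonneg_left
        (mul_le_of_le_one_right (norm_nonneg _) (pow_le_one₀ hu.1.le hu.2)) (norm_nonneg _))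
  have hval : ∫ u in Ioc (0 : ℝ) 1, ∑' m, E m * (W u * (u : ℂ) ^ (∑ i, m i)) =
      ∫ u in Ioc (0 : ℝ) 1, W u * eulerKernel b ((u : ℂ), x) := by
    refine setIntegral_congr_fun measurableSet_Ioc fun u hu => ?_
    have hux : ∀ i, ‖(u : ℂ) * x i‖ < 1 := fun i => by
      rw [norm_mul, Complex.norm_real, Real.norm_of_nonneg hu.1.le]
      exact (mul_le_of_le_one_left (norm_nonneg _) hu.2).trans_lt (hx i)
    simp only [eulerKernel]
    rw [← (prod_one_sub_cpow_neg_series b _ hux).2.tsum_eq, ← tsum_mul_left]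
    refine tsum_congr fun m => ?_
    simp only [E, mul_pow, Finset.prod_mul_distrib, Finset.prod_pow_eq_pow_sum]
    ring
  rw [hval] at hsum
  refine (hsum.mul_left B⁻¹).congr_fun fun m => ?_
  rw [integral_const_mul, (hpow _).2, lauricellaFDTerm_eq]
  simp only [E]
  field_simp

theorem isLauricellaFD_lauricellaFD {n : ℕ} {α c : ℝ} (hα : 0 < α) (hαc : α < c)
    (b : Fin n → ℂ) : IsLauricellaFD (α : ℂ) b (c : ℂ) (lauricellaFD (α : ℂ) b (c : ℂ)) :=
  Classical.epsilon_spec (exists_isLauricellaFD hα hαc b)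

/-! ### Principal powers in the right half-plane -/

theorem re_inv_pos {z : ℂ} (hz : 0 < z.re) : 0 < (z⁻¹).re := by
  rw [Complex.inv_re]
  exact div_pos hz (Complex.normSq_pos.2 fun h => by simp [h] at hz)

theorem ne_zero_of_re_pos {z : ℂ} (hz : 0 < z.re) : z ≠ 0 := fun h => by simp [h] at hz

/-- Otherwise `a = r z` with `r ≤ -1` real, contradicting the signs of the real parts. -/
theorem one_add_div_mem_slitPlane {a z : ℂ} (ha : 0 < a.re) (hz : 0 < z.re) :
    1 + a / z ∈ Complex.slitPlane := by
  have hz0 := ne_zero_of_re_pos hz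
  rw [Complex.mem_slitPlane_iff]
  by_contra! h
  obtain ⟨h1, h2⟩ := h
  have hw : a / z = (((a / z).re : ℝ) : ℂ) := by
    apply Complex.ext <;> simp_all
  have hre : (a / z).re ≤ -1 := by
    simp only [Complex.add_re, Complex.one_re] at h1
    linarith
  have haz : a = (((a / z).re : ℝ) : ℂ) * z := by
    rw [← hw, div_mul_cancel₀ _ hz0]
  have := congrArg Complex.re haz
  rw [Complex.re_ofReal_mul] at this
  nlinarith

/-- The principal logarithm is additive here: `t` is positive, while `a + t` and `a⁻¹` have
arguments below `π/2` in absolute value. -/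
theorem one_add_div_cpow {a b : ℂ} (ha : 0 < a.re) {t : ℝ} (ht : 0 < t) :
    (1 + (t : ℂ) / a) ^ (-b) = a ^ b * ((t : ℂ) ^ (-b) * (1 + a / (t : ℂ)) ^ (-b)) := by
  have hne : ∀ {w : ℂ}, 0 < w.re → w ≠ 0 := fun hw => ne_zero_of_re_pos hw
  have ha0 := hne ha
  have ht0 : (t : ℂ) ≠ 0 := by exact_mod_cast ht.ne'
  have hat : 0 < (a + t).re := by simpa using add_pos ha ht
  have h1 : (1 : ℂ) + a / t ≠ 0 := by
    rw [show (1 : ℂ) + a / t = (a + t) / t by field_simp; ring]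
    exact div_ne_zero (hne hat) ht0
  have e1 : Complex.log (a + t) = Complex.log t + Complex.log (1 + a / t) := by
    rw [show a + t = (t : ℂ) * (1 + a / t) by field_simp; ring, Complex.log_ofReal_mul ht h1,
      Complex.ofReal_log ht.le]
  have hinv := re_inv_pos ha
  have hlogdiv : Complex.log ((a + t) * a⁻¹) = Complex.log (a + t) + Complex.log a⁻¹ := by
    refine Complex.log_mul (hne hat) (hne hinv) ?_
    have h2 := abs_lt.1 (Complex.abs_arg_lt_pi_div_two_iff.2 (Or.inl hat))
    have h3 := abs_lt.1 (Complex.abs_arg_lt_pi_div_two_iff.2 (Or.inl hinv))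
    constructor <;> linarith [h2.1, h2.2, h3.1, h3.2]
  have hlinv : Complex.log a⁻¹ = -Complex.log a :=
    Complex.log_inv _ fun h => by
      have h2 := (abs_lt.1 (Complex.abs_arg_lt_pi_div_two_iff.2 (Or.inl ha))).2
      rw [h] at h2
      linarith [Real.pi_pos]
  have e2 : (1 : ℂ) + t / a = (a + t) * a⁻¹ := by field_simp
  have h4 : (1 : ℂ) + t / a ≠ 0 := by
    rw [e2]; exact mul_ne_zero (hne hat) (hne hinv)
  rw [Complex.cpow_def_of_ne_zero h4, Complex.cpow_def_of_ne_zero ha0,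
    Complex.cpow_def_of_ne_zero ht0, Complex.cpow_def_of_ne_zero h1, ← Complex.exp_add,
    ← Complex.exp_add, e2, hlogdiv, hlinv, e1]
  ring_nf

theorem prod_one_add_div_cpow {n : ℕ} {a b : Fin n → ℂ} (ha : ∀ i, 0 < (a i).re) {t : ℝ}
    (ht : 0 < t) :
    ∏ i, (1 + (t : ℂ) / a i) ^ (-b i) =
      (∏ i, a i ^ b i) * ((t : ℂ) ^ (-∑ i, b i) * ∏ i, (1 + a i / (t : ℂ)) ^ (-b i)) := by
  have ht0 : (t : ℂ) ≠ 0 := by exact_mod_cast ht.ne'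
  have hsum : (t : ℂ) ^ (-∑ i, b i) = ∏ i, (t : ℂ) ^ (-b i) := by
    simp only [Complex.cpow_def_of_ne_zero ht0]
    rw [← Complex.exp_sum, ← Finset.sum_neg_distrib, Finset.mul_sum]
  rw [hsum, ← Finset.prod_mul_distrib, ← Finset.prod_mul_distrib]
  exact Finset.prod_congr rfl fun i _ => one_add_div_cpow (ha i) ht

/-- Functions that are continuous from the right and agree almost everywhere on the half-line
agree everywhere on it. -/
theorem eq_zero_of_ae_eq_zero_of_rightContinuous {f : ℝ → ℂ}
    (hf : ∀ᵐ x ∂volume.restrict (Ioi (0 : ℝ)), f x = 0)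
    (hc : ∀ x, 0 ≤ x → ContinuousWithinAt f (Ioi x) x) {x : ℝ} (hx : 0 ≤ x) : f x = 0 := by
  by_contra hne
  -- A nonzero value would persist on an interval to the right of `x`, which has positive measure.
  obtain ⟨y, hy, hsub⟩ := mem_nhdsGT_iff_exists_Ioo_subset.1 ((hc x hx).eventually_ne hne)
  have hy' : x < y := hy
  have h0 : volume (Ioo x y) = 0 := by
    refine measure_mono_null (fun z hz => ?_) ((ae_restrict_iff' measurableSet_Ioi).1 hf)
    simp only [mem_compl_iff, mem_ofPred_eq, Classical.not_imp]
    exact ⟨hx.trans_lt hz.1, hsub hz⟩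
  rw [Real.volume_Ioo, ENNReal.ofReal_eq_zero] at h0
  linarith

/-! ### Holomorphic continuation and the two formulas -/

/-- The integral is the complex moment generating function, at `-z`, of the measure with density
`k`, hence holomorphic inside its strip of integrability. -/
theorem differentiableOn_laplace {k : ℝ → ℝ} (hk : Measurable k) (hk0 : ∀ x, 0 ≤ k x)
    (hint : ∀ t, 0 < t → IntegrableOn (fun x => k x * Real.exp (-(t * x))) (Ioi 0)) :
    DifferentiableOn ℂ (fun z : ℂ => ∫ x in Ioi (0 : ℝ), (k x : ℂ) * Complex.exp (-(z * x)))
      {z | 0 < z.re} := by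
  have hkm : Measurable fun x => ENNReal.ofReal (k x) := hk.ennreal_ofReal
  let m : Measure ℝ := (volume.restrict (Ioi 0)).withDensity fun x => ENNReal.ofReal (k x)
  have hmgf : ∀ z : ℂ, ∫ x in Ioi (0 : ℝ), (k x : ℂ) * Complex.exp (-(z * x)) =
      complexMGF id m (-z) := by
    intro z
    rw [complexMGF, integral_withDensity_eq_integral_toReal_smul hkm
      (.of_forall fun x => ENNReal.ofReal_lt_top)]
    refine integral_congr_ae (.of_forall fun x => ?_)
    simp [ENNReal.toReal_ofReal (hk0 x)]
  have hset : Iio (0 : ℝ) ⊆ integrableExpSet id m := by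
    intro s hs
    rw [integrableExpSet, mem_ofPred_eq,
      integrable_withDensity_iff_integrable_smul' hkm (.of_forall fun x => ENNReal.ofReal_lt_top)]
    refine (hint (-s) (neg_pos.2 hs)).congr (.of_forall fun x => ?_)
    simp [ENNReal.toReal_ofReal (hk0 x)]
  simp only [hmgf]
  refine (differentiableOn_complexMGF (X := id) (μ := m)).comp (by fun_prop) fun z hz => ?_
  refine interior_mono hset ?_
  rw [isOpen_Iio.interior_eq]
  simpa using hz

/-- Monotonicity serves to make the integrand of the `Q`-transform measurable. -/
theorem gaussianQ_antitone : Antitone gaussianQ := by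
  have hi : Integrable fun u : ℝ => Real.exp (-u ^ 2 / 2) := by
    refine (integrable_exp_neg_mul_sq (b := 1 / 2) (by norm_num)).congr (.of_forall fun u => ?_)
    simp only
    ring_nf
  intro x y hxy
  refine mul_le_mul_of_nonneg_left ?_ (by positivity)
  exact setIntegral_mono_set hi.integrableOn (.of_forall fun u => (Real.exp_pos _).le)
    (Ioi_subset_Ioi hxy).eventuallyLE

theorem gaussianQTransform_eq_integral_cdf {Ω : Type*} [MeasurableSpace Ω] {μ : Measure Ω}
    [IsProbabilityMeasure μ] {γ : Ω → ℝ} (hm : AEMeasurable γ μ) (h0 : ∀ᵐ ω ∂μ, 0 ≤ γ ω)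
    {p : ℝ} (hp : 0 < p) :
    gaussianQTransform μ γ p = Real.sqrt p / (2 * Real.sqrt (2 * Real.pi)) *
      ∫ x in Ioi (0 : ℝ),
        cdf (μ.map γ) x * (x ^ ((1 / 2 : ℝ) - 1) * Real.exp (-(p / 2 * x))) := by
  have := Measure.isProbabilityMeasure_map hm
  have hP : ∀ᵐ y ∂μ.map γ, 0 ≤ y := (ae_map_iff hm measurableSet_Ici).2 h0
  have hmeas : Measurable fun y : ℝ => gaussianQ (Real.sqrt (p * y)) :=
    gaussianQ_antitone.measurable.comp (by fun_prop)
  have hw := (integrableOn_rpow_mul_exp_neg_mul (ν := 1 / 2) (t := p / 2) (by norm_num)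
    (by positivity)).const_mul (Real.sqrt p / (2 * Real.sqrt (2 * Real.pi)))
  rw [gaussianQTransform, ← integral_map (f := fun y => gaussianQ (Real.sqrt (p * y))) hm
    hmeas.aestronglyMeasurable, ← integral_const_mul]
  rw [integral_congr_ae (hP.mono fun y hy => gaussianQ_sqrt_mul hp hy),
    ← integral_cdf_mul _ hP hw]
  refine integral_congr_ae (.of_forall fun x => ?_)
  simp only
  ring

/-- The distribution function of a nonnegative random variable with monomial moment generating
function, with real exponent `β = ∑ bᵢ`. -/
theorem cdf_eq_lauricellaPhi2 (P : Measure ℝ) [IsProbabilityMeasure P] (hP : ∀ᵐ y ∂P, 0 ≤ y)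
    {n : ℕ} {a b : Fin n → ℂ} (ha : ∀ i, 0 < (a i).re) {β : ℝ} (hβ : 0 < β)
    (hb : ∑ i, b i = (β : ℂ))
    (hM : ∀ t : ℝ, 0 < t → ((∫ y, Real.exp (-(t * y)) ∂P : ℝ) : ℂ) =
      ∏ i, (1 + (t : ℂ) / a i) ^ (-b i)) {x : ℝ} (hx : 0 ≤ x) :
    ((cdf P x : ℝ) : ℂ) = (∏ i, a i ^ b i) / Complex.Gamma ((1 + β : ℝ) : ℂ) *
      ((x ^ β : ℝ) : ℂ) * lauricellaPhi2 b ((1 + β : ℝ) : ℂ) (fun i => -a i * (x : ℂ)) := by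
  set A := (∏ i, a i ^ b i) / Complex.Gamma ((1 + β : ℝ) : ℂ) with hA
  set Φ : ℝ → ℂ := fun x => lauricellaPhi2 b ((1 + β : ℝ) : ℂ) (fun i => -a i * (x : ℂ)) with hΦ
  have hβ1 : 0 < 1 + β := by positivity
  have hc1 : 1 ≤ 1 + β := by linarith
  obtain ⟨T, hT, haT⟩ := exists_norm_bound (fun i => -a i)
  have hcdf : ∀ t : ℝ, 0 < t →
      IntegrableOn (fun x => (Real.exp (-(t * x)) : ℂ) * ((cdf P x : ℝ) : ℂ)) (Ioi 0) ∧
      ∫ x in Ioi (0 : ℝ), (Real.exp (-(t * x)) : ℂ) * ((cdf P x : ℝ) : ℂ) =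
        (∏ i, (1 + (t : ℂ) / a i) ^ (-b i)) / t := by
    intro t ht
    have hw : IntegrableOn (fun x : ℝ => Real.exp (-(t * x))) (Ioi 0) := by
      simpa using integrableOn_rpow_mul_exp_neg_mul one_pos ht
    have heq : (fun x => (Real.exp (-(t * x)) : ℂ) * ((cdf P x : ℝ) : ℂ)) =
        fun x => ((cdf P x * Real.exp (-(t * x)) : ℝ) : ℂ) := by
      ext x; push_cast; ring
    rw [heq]
    refine ⟨(integrableOn_cdf_mul P hw).ofReal, ?_⟩
    rw [integral_complex_ofReal, integral_cdf_mul P hP hw]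
    simp only [integral_Ioi_exp_neg_mul ht]
    rw [integral_div, Complex.ofReal_div, hM t ht]
  -- Here `ν = c = 1 + β`, so `F_D` collapses to binomials; `T` exceeds all `‖aᵢ‖`, which puts
  -- `-aᵢ/t` in the unit disc.
  have hG : ∀ t : ℝ, T ≤ t →
      IntegrableOn (fun x => (Real.exp (-(t * x)) : ℂ) * (A * ((x ^ β : ℝ) : ℂ) * Φ x)) (Ioi 0) ∧
      ∫ x in Ioi (0 : ℝ), (Real.exp (-(t * x)) : ℂ) * (A * ((x ^ β : ℝ) : ℂ) * Φ x) =
        (∏ i, (1 + (t : ℂ) / a i) ^ (-b i)) / t := by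
    intro t ht
    have ht0 : 0 < t := hT.trans_le ht
    have htc : (t : ℂ) ≠ 0 := by exact_mod_cast ht0.ne'
    have hat : ∀ i, ‖-a i‖ < t := fun i => (haT i).trans_le ht
    obtain ⟨h1, h2⟩ := laplace_lauricellaPhi2 hβ1 le_rfl hc1 b (fun i => -a i) hat ht0
    have h3 := (hasSum_lauricellaFDTerm_self hβ1 b _
      fun i => norm_div_ofReal_lt_one (hat i)).mul_left
        (((Real.Gamma (1 + β) * (1 / t) ^ (1 + β) : ℝ) : ℂ))
    have h4 := h2.unique h3
    have heq : (fun x => (Real.exp (-(t * x)) : ℂ) * (A * ((x ^ β : ℝ) : ℂ) * Φ x)) =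
        fun x => A * (((x ^ (1 + β - 1) * Real.exp (-(t * x)) : ℝ) : ℂ) * Φ x) := by
      ext x
      rw [add_sub_cancel_left]
      push_cast
      ring
    rw [heq]
    refine ⟨h1.const_mul A, ?_⟩
    rw [integral_const_mul, h4, prod_one_add_div_cpow ha ht0, hb, hA]
    have hΓ := Gamma_ofReal_ne_zero hβ1
    have hpow : (((1 / t) ^ (1 + β) : ℝ) : ℂ) = (t : ℂ) ^ (-(β : ℂ)) / t := by
      rw [Real.rpow_add (by positivity), Real.rpow_one, one_div, Real.inv_rpow ht0.le,
        ← Real.rpow_neg ht0.le, Complex.ofReal_mul, Complex.ofReal_cpow ht0.le]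
      push_cast
      field_simp
    rw [Complex.ofReal_mul, hpow, ← Complex.Gamma_ofReal]
    simp only [neg_div, sub_neg_eq_add]
    field_simp
  have hae : ∀ᵐ x ∂volume.restrict (Ioi (0 : ℝ)),
      ((cdf P x : ℝ) : ℂ) - A * ((x ^ β : ℝ) : ℂ) * Φ x = 0 := by
    refine ae_eq_zero_of_laplace_eq_zero (T := T) ?_ fun k => ?_
    · simp only [mul_sub]
      exact (hcdf T hT).1.sub (hG T le_rfl).1
    · have hk : T ≤ T + k := le_add_of_nonneg_right k.cast_nonneg
      simp only [mul_sub]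
      rw [integral_sub (hcdf _ (hT.trans_le hk)).1 (hG _ hk).1, (hcdf _ (hT.trans_le hk)).2,
        (hG _ hk).2, sub_self]
  refine sub_eq_zero.1 (eq_zero_of_ae_eq_zero_of_rightContinuous
    (f := fun x => ((cdf P x : ℝ) : ℂ) - A * ((x ^ β : ℝ) : ℂ) * Φ x) hae (fun y hy => ?_) hx)
  have hsub : Ioi y ⊆ Ici 0 := fun z hz => hy.trans (le_of_lt hz)
  refine ContinuousWithinAt.sub ?_ (ContinuousWithinAt.mul (ContinuousWithinAt.mul
    continuousWithinAt_const ?_) ?_)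
  · exact Complex.continuous_ofReal.continuousAt.comp_continuousWithinAt
      (((cdf P).right_continuous y).mono Ioi_subset_Ici_self)
  · exact (Complex.continuous_ofReal.comp
      (Real.continuous_rpow_const hβ.le)).continuousWithinAt
  · exact (continuousOn_lauricellaPhi2 hc1 b _ y hy).mono hsub

/-- The Laplace transform of `x ^ (-1/2) F(x)`, where `F` has the confluent Lauricella form. -/
theorem laplace_cdf_eq_lauricellaFD (P : Measure ℝ) {n : ℕ} {a b : Fin n → ℂ}
    (ha : ∀ i, 0 < (a i).re) {β : ℝ} (hβ : 0 < β) {A : ℂ}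
    (hF : ∀ x : ℝ, 0 ≤ x → ((cdf P x : ℝ) : ℂ) = A * ((x ^ β : ℝ) : ℂ) *
      lauricellaPhi2 b ((1 + β : ℝ) : ℂ) (fun i => -a i * (x : ℂ))) {z : ℂ} (hz : 0 < z.re) :
    ∫ x in Ioi (0 : ℝ), ((cdf P x * x ^ ((1 / 2 : ℝ) - 1) : ℝ) : ℂ) * Complex.exp (-(z * x)) =
      A * Complex.Gamma ((1 / 2 + β : ℝ) : ℂ) * (z⁻¹ ^ ((1 / 2 + β : ℝ) : ℂ) *
        lauricellaFD ((1 / 2 + β : ℝ) : ℂ) b ((1 + β : ℝ) : ℂ) (fun i => -a i / z)) := by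
  have hν : 0 < 1 / 2 + β := by positivity
  have hνc : 1 / 2 + β < 1 + β := by linarith
  have hFD := isLauricellaFD_lauricellaFD hν hνc b
  -- `differentiableOn_laplace` asks for nonnegativity on the whole line; the maximum secures it and
  -- changes nothing for `x > 0`.
  let k : ℝ → ℝ := fun x => cdf P x * max (x ^ ((1 / 2 : ℝ) - 1)) 0
  have hkeq : ∀ x ∈ Ioi (0 : ℝ), k x = cdf P x * x ^ ((1 / 2 : ℝ) - 1) := fun x hx => by
    simp only [k]
    rw [max_eq_left (Real.rpow_nonneg (le_of_lt hx) _)]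
  have hL : DifferentiableOn ℂ (fun z : ℂ => ∫ x in Ioi (0 : ℝ),
      ((cdf P x * x ^ ((1 / 2 : ℝ) - 1) : ℝ) : ℂ) * Complex.exp (-(z * x))) {z | 0 < z.re} := by
    refine (differentiableOn_laplace (k := k) ?_ (fun x => ?_) fun t ht => ?_).congr
      fun w _ => setIntegral_congr_fun measurableSet_Ioi fun x hx => by simp only [hkeq x hx]
    · exact (cdf P).mono.measurable.mul (by fun_prop)
    · exact mul_nonneg (cdf_nonneg P x) (le_max_right _ _)
    · refine (integrableOn_cdf_mul P (integrableOn_rpow_mul_exp_neg_mul (ν := 1 / 2) (t := t)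
        (by norm_num) ht)).congr_fun (fun x hx => ?_) measurableSet_Ioi
      simp only [hkeq x hx, mul_assoc]
  have hR : DifferentiableOn ℂ (fun z : ℂ => A * Complex.Gamma ((1 / 2 + β : ℝ) : ℂ) *
      (z⁻¹ ^ ((1 / 2 + β : ℝ) : ℂ) *
        lauricellaFD ((1 / 2 + β : ℝ) : ℂ) b ((1 + β : ℝ) : ℂ) (fun i => -a i / z)))
      {z | 0 < z.re} := by
    refine DifferentiableOn.const_mul (DifferentiableOn.mul (fun w hw => ?_) ?_) _
    · have hw0 := ne_zero_of_re_pos hw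
      exact ((differentiableAt_inv hw0).cpow (differentiableAt_const _)
        (Complex.mem_slitPlane_iff.2 (Or.inl (re_inv_pos hw)))).differentiableWithinAt
    · refine hFD.1.comp (f := fun w : ℂ => fun i => -a i / w) ?_ fun w hw i => ?_
      · refine differentiableOn_pi.2 fun i w hw => ?_
        have hw0 : w ≠ 0 := ne_zero_of_re_pos hw
        exact (DifferentiableAt.div (differentiableAt_const _) differentiableAt_id
          hw0).differentiableWithinAt
      · simp only
        rw [neg_div, sub_neg_eq_add]
        exact one_add_div_mem_slitPlane (ha i) hw
  have hopen : IsOpen {z : ℂ | 0 < z.re} := isOpen_lt continuous_const Complex.continuous_re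
  obtain ⟨T, hT, haT⟩ := exists_norm_bound (fun i => -a i)
  have hreal : ∀ t : ℝ, T < t →
      ∫ x in Ioi (0 : ℝ),
        ((cdf P x * x ^ ((1 / 2 : ℝ) - 1) : ℝ) : ℂ) * Complex.exp (-((t : ℂ) * x)) =
      A * Complex.Gamma ((1 / 2 + β : ℝ) : ℂ) * ((t : ℂ)⁻¹ ^ ((1 / 2 + β : ℝ) : ℂ) *
        lauricellaFD ((1 / 2 + β : ℝ) : ℂ) b ((1 + β : ℝ) : ℂ) (fun i => -a i / (t : ℂ))) := by
    intro t ht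
    have ht0 : 0 < t := hT.trans ht
    have hat : ∀ i, ‖-a i‖ < t := fun i => (haT i).trans ht
    have h2 := (laplace_lauricellaPhi2 hν hνc.le (by linarith : 1 ≤ 1 + β) b
      (fun i => -a i) hat ht0).2
    have h3 := (hFD.2 _ fun i => norm_div_ofReal_lt_one (hat i)).mul_left
      (((Real.Gamma (1 / 2 + β) * (1 / t) ^ (1 / 2 + β) : ℝ) : ℂ))
    have h4 := h2.unique h3
    have hint : ∫ x in Ioi (0 : ℝ),
        ((cdf P x * x ^ ((1 / 2 : ℝ) - 1) : ℝ) : ℂ) * Complex.exp (-((t : ℂ) * x)) =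
        ∫ x in Ioi (0 : ℝ), A * (((x ^ (1 / 2 + β - 1) * Real.exp (-(t * x)) : ℝ) : ℂ) *
          lauricellaPhi2 b ((1 + β : ℝ) : ℂ) (fun i => -a i * (x : ℂ))) := by
      refine setIntegral_congr_fun measurableSet_Ioi fun x hx => ?_
      have hx0 : 0 < x := hx
      rw [Complex.ofReal_mul, hF x hx0.le,
        show 1 / 2 + β - 1 = β + (1 / 2 - 1) by ring, Real.rpow_add hx0]
      push_cast
      ring
    rw [hint, integral_const_mul, h4, one_div t, Complex.ofReal_mul,
      Complex.ofReal_cpow (by positivity), ← Complex.Gamma_ofReal, Complex.ofReal_inv]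
    ring
  -- Identity theorem at `T + 1`, an accumulation point of the real ray on which the series
  -- computation is valid.
  refine (hL.analyticOnNhd hopen).eqOn_of_preconnected_of_frequently_eq (hR.analyticOnNhd hopen)
    (convex_halfSpace_re_gt 0).isPreconnected (z₀ := ((T + 1 : ℝ) : ℂ)) ?_ ?_ hz
  · simp only [mem_ofPred_eq, Complex.ofReal_re]
    positivity
  · have htend : Tendsto (fun t : ℝ => (t : ℂ)) (𝓝[≠] (T + 1)) (𝓝[≠] ((T + 1 : ℝ) : ℂ)) :=
      Complex.continuous_ofReal.continuousWithinAt.tendsto_nhdsWithin fun t ht =>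
        Complex.ofReal_injective.ne ht
    refine htend.frequently (Eventually.frequently ?_)
    filter_upwards [mem_nhdsWithin_of_mem_nhds (Ioi_mem_nhds (lt_add_one T))] with t ht
    exact hreal t ht

theorem integral_exp_neg_mul_map {Ω : Type*} [MeasurableSpace Ω] {μ : Measure Ω}
    {γ : Ω → ℝ} (hm : AEMeasurable γ μ) (t : ℝ) :
    ((∫ y, Real.exp (-(t * y)) ∂(μ.map γ) : ℝ) : ℂ) = complexMGF γ μ (-(t : ℂ)) := by
  rw [integral_map hm (by fun_prop), ← integral_complex_ofReal, complexMGF]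
  refine integral_congr_ae (.of_forall fun ω => ?_)
  simp

end LauricellaTransforms

theorem theorem1 {Ω : Type*} [MeasurableSpace Ω] (μ : Measure Ω) [IsProbabilityMeasure μ]
    (γ : Ω → ℝ) (hγ_meas : AEMeasurable γ μ) (hγ_nonneg : ∀ᵐ ω ∂μ, 0 ≤ γ ω)
    (n : ℕ) (a b : Fin n → ℂ) (ha : ∀ i, 0 < (a i).re)
    (hb_pos : 0 < (∑ i, b i).re) (hb_real : (∑ i, b i).im = 0)
    (hMGF : ∀ s : ℂ, s.re ≤ 0 → complexMGF γ μ s = ∏ i, (1 - s / a i) ^ (-b i)) :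
    (∀ x : ℝ, 0 ≤ x →
      Summable (lauricellaPhi2Term b (1 + ∑ i, b i) (fun i => -a i * (x : ℂ))) ∧
      ((cdf (μ.map γ) x : ℝ) : ℂ) =
        (∏ i, a i ^ b i) / Complex.Gamma (1 + ∑ i, b i) * (x : ℂ) ^ (∑ i, b i) *
          lauricellaPhi2 b (1 + ∑ i, b i) (fun i => -a i * (x : ℂ))) ∧
    IsLauricellaFD (1 / 2 + ∑ i, b i) b (1 + ∑ i, b i)
      (lauricellaFD (1 / 2 + ∑ i, b i) b (1 + ∑ i, b i)) ∧
    (∀ p : ℝ, 0 < p →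
      ((gaussianQTransform μ γ p : ℝ) : ℂ) =
        1 / (2 * (Real.sqrt Real.pi : ℂ)) * (∏ i, a i ^ b i) *
          (Complex.Gamma (1 / 2 + ∑ i, b i) / Complex.Gamma (1 + ∑ i, b i)) *
          (2 / (p : ℂ)) ^ (∑ i, b i) *
          lauricellaFD (1 / 2 + ∑ i, b i) b (1 + ∑ i, b i)
            (fun i => -(2 * a i / (p : ℂ)))) := by
  obtain ⟨β, hb⟩ : ∃ β : ℝ, ∑ i, b i = (β : ℂ) :=
    ⟨(∑ i, b i).re, Complex.ext (by simp) (by simpa using hb_real)⟩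
  have hβ : 0 < β := by simpa [hb] using hb_pos
  have hP := Measure.isProbabilityMeasure_map hγ_meas
  have hP0 : ∀ᵐ y ∂μ.map γ, 0 ≤ y := (ae_map_iff hγ_meas measurableSet_Ici).2 hγ_nonneg
  have hM : ∀ t : ℝ, 0 < t → ((∫ y, Real.exp (-(t * y)) ∂(μ.map γ) : ℝ) : ℂ) =
      ∏ i, (1 + (t : ℂ) / a i) ^ (-b i) := fun t ht => by
    rw [integral_exp_neg_mul_map hγ_meas, hMGF _ (by simpa using ht.le)]
    simp only [neg_div, sub_neg_eq_add]
  have hF := fun (x : ℝ) (hx : 0 ≤ x) => cdf_eq_lauricellaPhi2 (μ.map γ) hP0 ha hβ hb hM hx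
  have e1 : (1 : ℂ) + β = ((1 + β : ℝ) : ℂ) := by push_cast; rfl
  have e2 : (1 / 2 : ℂ) + β = ((1 / 2 + β : ℝ) : ℂ) := by push_cast; rfl
  rw [hb, e1, e2]
  refine ⟨fun x hx => ⟨summable_lauricellaPhi2Term (by linarith) b _ hx, ?_⟩,
    isLauricellaFD_lauricellaFD (by positivity) (by linarith) b, fun p hp => ?_⟩
  · rw [hF x hx, Complex.ofReal_cpow hx]
  · have hL := laplace_cdf_eq_lauricellaFD (μ.map γ) ha hβ hF (z := ((p / 2 : ℝ) : ℂ))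
      (by simpa using hp)
    have hcast : ((∫ x in Set.Ioi (0 : ℝ), cdf (μ.map γ) x *
        (x ^ ((1 / 2 : ℝ) - 1) * Real.exp (-(p / 2 * x))) : ℝ) : ℂ) =
        ∫ x in Set.Ioi (0 : ℝ), ((cdf (μ.map γ) x * x ^ ((1 / 2 : ℝ) - 1) : ℝ) : ℂ) *
          Complex.exp (-(((p / 2 : ℝ) : ℂ) * x)) := by
      rw [← integral_complex_ofReal]
      refine integral_congr_ae (.of_forall fun x => ?_)
      push_cast
      ring
    -- The half power splits off as `√2/√p`; its `√p` cancels against the prefactor of the Gaussian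
    -- tail.
    have hpow : ((p / 2 : ℝ) : ℂ)⁻¹ ^ ((1 / 2 + β : ℝ) : ℂ) =
        ((Real.sqrt 2 / Real.sqrt p : ℝ) : ℂ) * (2 / (p : ℂ)) ^ (β : ℂ) := by
      have h2p : (2 / (p : ℂ)) = ((2 / p : ℝ) : ℂ) := by push_cast; rfl
      rw [← Complex.ofReal_inv, inv_div, h2p, ← Complex.ofReal_cpow (by positivity),
        ← Complex.ofReal_cpow (by positivity), Real.rpow_add (by positivity),
        ← Real.sqrt_eq_rpow, Real.sqrt_div zero_le_two, Complex.ofReal_mul]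
    have hconst : ((Real.sqrt p / (2 * Real.sqrt (2 * Real.pi)) : ℝ) : ℂ) *
        ((Real.sqrt 2 / Real.sqrt p : ℝ) : ℂ) = 1 / (2 * (Real.sqrt Real.pi : ℂ)) := by
      rw [← Complex.ofReal_mul, Real.sqrt_mul zero_le_two]
      have h1 : Real.sqrt p ≠ 0 := by positivity
      have h2 : Real.sqrt 2 ≠ 0 := by positivity
      have h3 : Real.sqrt Real.pi ≠ 0 := by positivity
      rw [show Real.sqrt p / (2 * (Real.sqrt 2 * Real.sqrt Real.pi)) *
        (Real.sqrt 2 / Real.sqrt p) = 1 / (2 * Real.sqrt Real.pi) by field_simp]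
      push_cast
      rfl
    have harg : (fun i => -a i / ((p / 2 : ℝ) : ℂ)) = fun i => -(2 * a i / (p : ℂ)) := by
      ext i
      have : (p : ℂ) ≠ 0 := by exact_mod_cast hp.ne'
      push_cast
      field_simp
    rw [gaussianQTransform_eq_integral_cdf hγ_meas hγ_nonneg hp, Complex.ofReal_mul, hcast, hL,
      hpow, harg, ← hconst]
    ring
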